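/- An independence system $(\mathcal N,\mathcal I)$ (that is, $\mathcal I\subseteq 2^{\mathcal N}$ is non-empty and closed under subsets) on a finite set $\mathcal N$ is *$k$-extendible* if for all $A\subseteq B$ in $\mathcal I$ and every $u\in\mathcal N\setminus B$ with $A\cup\{u\}\in\mathcal I$ there is $Y\subseteq B\setminus A$ with $|Y|\le k$ and $(B\setminus Y)\cup\{u\}\in\mathcal I$. An algorithm for maximizing $f$ over $\mathcal I$ accesses $f:2^{\mathcal N}\to\mathbb R$ and $\mathcal I$ only through adaptive queries to a value oracle ($S\mapsto f(S)$) and an independence oracle ($S\mapsto$ whether $S\in\mathcal I$). A randomized algorithm is a random choice of a deterministic one. It achieves the approximation ratio $\alpha$ on a class of instances if on each of them it (almost surely) outputs a set $T\in\mathcal I$ and $\max_{S\in\mathcal I}f(S)\le\alpha\,\mathbb E[f(T)]$. **Theorem.** Let $k\ge 1$ be an integer. 1. For every constant $\varepsilon>0$, no (deterministic or randomized) algorithm making a number of oracle queries polynomial in $n=|\mathcal N|$ achieves the approximation ratio $k-\varepsilon$ for maximizing a non-negative linear (modular) function over $k$-extendible systems in which all singletons are independent. The same holds even if the objective is only allowed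 to be the cardinality function $f(S)=|S|$. 2. Let $h,m\ge1$ be integers with $2k\mid h$, let $\mathcal N$ be the disjoint union of $H_1,\dots,H_h$ with $|H_i|=km$, let $$g(x)=\min\{x,\tfrac{2km}{h}\}+\max\{\tfrac{x-2km/h}{k},0\},$$ let $\mathcal M$ be the system on $\mathcal N$ in which $S$ is independent iff $g(|S\cap H_1|)+|S\setminus H_1|\le m$, and let $\mathcal M'$ be the uniform matroid of rank $m$ on $\mathcal N$. Then: - $\mathcal M$ and $\mathcal M'$ are $k$-extendible systems. - $\mathcal M$ has an independent set $S\subseteq H_1$ of size $\lfloor k(m-\frac{2km}{h})+\frac{2km}{h}\rfloor$, and this size is at least $mk(1-\frac{2k}{h})$ whenever $h\le 2km$. - For every deterministic algorithm with access to the value oracle of the cardinality function and to an independence oracle, and with results in an arbitrary set, if $q$ is the number of queries that it makes on $\mathcal M'$, then the probability that its result on $\sigma(\mathcal M)$ differs from its result on $\mathcal M'$, where $\sigma$ is a uniformly random permutation of $\mathcal N$, is at most $q\,e^{-2km/h^2}$. -/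

import Mathlib

universe u

namespace KExtHardness

/-- `(N, I)` is an independence system: `I` is non-empty and closed under taking subsets. -/
def IsIndependenceSystem {N : Type*} (I : Set (Finset N)) : Prop :=
  I.Nonempty ∧ ∀ A B : Finset N, A ⊆ B → B ∈ I → A ∈ I

/-- `(N, I)` is a `k`-extendible independence system. -/
def IsKExtendible {N : Type*} [DecidableEq N] (k : ℕ) (I : Set (Finset N)) : Prop :=
  IsIndependenceSystem I ∧
    ∀ (A B : Finset N) (x : N), A ⊆ B → A ∈ I → B ∈ I → x ∉ B → insert x A ∈ I →
      ∃ Y : Finset N, Y ⊆ B \ A ∧ Y.card ≤ k ∧ insert x (B \ Y) ∈ I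

/-- A set function is linear (modular): the marginal gain of an element does not depend on the
set to which it is added. -/
def IsLinear {N : Type*} [DecidableEq N] (f : Finset N → ℝ) : Prop :=
  ∀ (A B : Finset N) (x : N), A ⊆ B → x ∉ B → f (insert x A) - f A = f (insert x B) - f B

/-- An instance of the problem `max f(S)` subject to `S ∈ I` on the ground set `N`. -/
structure Problem (N : Type*) where
  /-- the objective function `f` -/
  value : Finset N → ℝ
  /-- the family `I` of independent sets -/
  indep : Set (Finset N)

/-- A deterministic adaptive algorithm on the ground set `N` with results in `β`, as a decision
tree: it either halts with a result, or makes one query to the value or the independence oracle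
and continues in a way that depends on the answer. -/
inductive OracleAlgorithm (N : Type*) (β : Type*) where
  | output (b : β) : OracleAlgorithm N β
  | valueQuery (S : Finset N) (next : ℝ → OracleAlgorithm N β) : OracleAlgorithm N β
  | indepQuery (S : Finset N) (next : Bool → OracleAlgorithm N β) : OracleAlgorithm N β

namespace OracleAlgorithm

open Classical in
/-- The result of the algorithm when its oracles answer according to the instance `P`. -/
noncomputable def run {N β : Type*} (P : Problem N) : OracleAlgorithm N β → β
  | output b => b
  | valueQuery S next => (next (P.value S)).run P
  | indepQuery S next => (next (decide (S ∈ P.indep))).run P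

open Classical in
/-- The number of oracle queries that the algorithm makes on the instance `P`. -/
noncomputable def numQueries {N β : Type*} (P : Problem N) : OracleAlgorithm N β → ℕ
  | output _ => 0
  | valueQuery S next => (next (P.value S)).numQueries P + 1
  | indepQuery S next => (next (decide (S ∈ P.indep))).numQueries P + 1

end OracleAlgorithm

/-- A randomized algorithm that outputs a subset of `N`: a deterministic oracle algorithm chosen
by a random seed from an arbitrary probability space. -/
structure RandomizedAlgorithm (N : Type*) where
  Seed : Type u
  [measurableSpace : MeasurableSpace Seed]
  law : MeasureTheory.Measure Seed
  [isProbabilityMeasure : MeasureTheory.IsProbabilityMeasure law]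
  alg : Seed → OracleAlgorithm N (Finset N)

attribute [instance] RandomizedAlgorithm.measurableSpace RandomizedAlgorithm.isProbabilityMeasure

/-- On every instance `P` of the class `C`, the randomized algorithm `A` makes (almost surely) at
most `q` oracle queries, outputs (almost surely) an independent set `T`, and achieves the
approximation ratio `α` in expectation: `f(S) ≤ α * E[f(T)]` for every independent set `S`. -/
def RandomizedAlgorithm.Approximates {N : Type*} (A : RandomizedAlgorithm.{u} N)
    (C : Set (Problem N)) (q : ℕ) (α : ℝ) : Prop :=
  ∀ P ∈ C,
    (∀ T : Finset N, MeasurableSet {ω | (A.alg ω).run P = T}) ∧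
    (∀ᵐ ω ∂A.law, (A.alg ω).numQueries P ≤ q) ∧
    (∀ᵐ ω ∂A.law, (A.alg ω).run P ∈ P.indep) ∧
    ∀ S ∈ P.indep, P.value S ≤ α * ∫ ω, P.value ((A.alg ω).run P) ∂A.law

/-- The instances whose objective is a non-negative linear function and whose constraint is a
`k`-extendible system in which all singletons are independent. -/
def linearProblems (k : ℕ) (N : Type*) [DecidableEq N] : Set (Problem N) :=
  {P | IsKExtendible k P.indep ∧ (∀ x : N, {x} ∈ P.indep) ∧
    IsLinear P.value ∧ ∀ S : Finset N, 0 ≤ P.value S}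

/-- The cardinality function `f(S) = |S|` as an objective, with constraint `I`. -/
def cardProblem {N : Type*} (I : Set (Finset N)) : Problem N where
  value := fun S => (S.card : ℝ)
  indep := I

/-- The instances whose objective is the cardinality function and whose constraint is a
`k`-extendible system in which all singletons are independent. -/
def cardProblems (k : ℕ) (N : Type*) [DecidableEq N] : Set (Problem N) :=
  {P | ∃ I : Set (Finset N), IsKExtendible k I ∧ (∀ x : N, {x} ∈ I) ∧ P = cardProblem I}

/-- There is a (possibly randomized, possibly non-uniform) algorithm which, for a class `C` of
instances on ground sets of every size `n`, makes a number of oracle queries that is polynomial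
in `n` and achieves the approximation ratio `α`. -/
def HasPolyQueryApproximation (C : (n : ℕ) → Set (Problem (Fin n))) (α : ℝ) : Prop :=
  ∃ (p : Polynomial ℕ) (A : (n : ℕ) → RandomizedAlgorithm.{u} (Fin n)),
    ∀ n : ℕ, (A n).Approximates (C n) (p.eval n) α

/-- The ground set of `M(k,h,m)`: `h` groups of `k * m` elements each. -/
abbrev Ground (k h m : ℕ) : Type := Fin h × Fin (k * m)

/-- The first group `H₁` of the ground set. -/
def firstGroup (k h m : ℕ) : Finset (Ground k h m) :=
  Finset.univ.filter fun x => x.1.val = 0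

/-- `g(x) = min {x, 2km/h} + max {(x - 2km/h)/k, 0}`. -/
noncomputable def resource (k h m : ℕ) (x : ℝ) : ℝ :=
  min x (2 * k * m / h) + max ((x - 2 * k * m / h) / k) 0

/-- The system `M(k,h,m)`: `S` is independent iff `g(|S ∩ H₁|) + |S \ H₁| ≤ m`. -/
def hardSystem (k h m : ℕ) : Set (Finset (Ground k h m)) :=
  {S | resource k h m ((S ∩ firstGroup k h m).card : ℝ) +
    ((S \ firstGroup k h m).card : ℝ) ≤ (m : ℝ)}

/-- The uniform matroid of rank `m` (for `m` at most the size of `N`): `S` is independent iff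
`|S| ≤ m`. -/
def uniformSystem (N : Type*) (m : ℕ) : Set (Finset N) :=
  {S | S.card ≤ m}

/-- The system obtained from `I` by applying the permutation `σ` to the ground set. -/
def permuted {N : Type*} (σ : Equiv.Perm N) (I : Set (Finset N)) : Set (Finset N) :=
  (fun S => S.map σ.toEmbedding) '' I

/-- The probability that a uniformly random permutation of `N` satisfies `E`. -/
noncomputable def permProb {N : Type*} (E : Equiv.Perm N → Prop) : ℝ :=
  (Nat.card {σ : Equiv.Perm N // E σ} : ℝ) / (Nat.card (Equiv.Perm N) : ℝ)

end KExtHardness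

/-!
Everything rests on one pair of instances: the system `M(k,h,m)` of a group `H` and the uniform
matroid of rank `m`. In the former, elements of `H` beyond the first `2km/h` cost only `1/k` each,
so `H` contains an independent set of about `km(1 - 2k/h)` elements
(`exists_subset_mem_groupSystem`), whereas the latter has only sets of at most `m` elements. Both
are `k`-extendible, because the slopes of the resource function lie between `1/k` and `1`
(`resource_sub_mem_Icc`, `isKExtendible_groupSystem`).

If `H` is replaced by its image under a random permutation `σ`, the two can hardly be told apart.
The two oracles can disagree only on sets with more than `m` elements, and a set of `m + 1`
elements on which they disagree meets `σ(H)` in at least `2km/h + 1` elements, more than twice the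
expected number if `k ≥ 2` (for `k = 1` the systems agree). The probability of this is bounded by
Markov's inequality for `2 ^ |S ∩ σ(H)|`: this number counts the `T ⊆ S` with `T ⊆ σ(H)`, and
`T ⊆ σ(H)` has probability at most `h ^ (-|T|)`, so that its expectation is at most
`(1 + 1/h) ^ |S|` (`sum_two_pow_card_inter_le`). This replaces a concentration inequality for the
hypergeometric distribution. A union bound over the queries that a decision tree makes on the
uniform matroid yields `permProb_run_ne_le`.

For a randomized algorithm, the guarantees on all `σ(M)` are averaged over `σ`, and the average is
exchanged with the expectation over the seed: for almost every seed the algorithm outputs at most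
`m` elements on the uniform matroid, hence on most `σ(M)`
(`ratio_bound_of_approximates`). With `h = 2kr` fixed and `m → ∞`, the error term, a polynomial
times an exponentially small factor, vanishes, and the ratio is at least `k(1 - 1/r)`.
-/

namespace KExtHardness

open Finset

/-! ### The resource function -/

section Resource

variable {k h m : ℕ}

theorem resource_zero : resource k h m 0 = 0 := by
  have ht : (0 : ℝ) ≤ 2 * k * m / h := by positivity
  have h2 : (0 - 2 * k * m / h : ℝ) / k ≤ 0 :=
    div_nonpos_of_nonpos_of_nonneg (by linarith) (by positivity)
  simp only [resource]
  rw [min_eq_left ht, max_eq_right h2, add_zero]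

/-- All slopes of the resource function lie in `[1/k, 1]`. -/
theorem resource_sub_mem_Icc (hk : 1 ≤ k) {x y : ℝ} (hxy : x ≤ y) :
    resource k h m y - resource k h m x ∈ Set.Icc ((y - x) / k) (y - x) := by
  simp only [resource]
  generalize (2 * k * m / h : ℝ) = t
  have hk1 : (1 : ℝ) ≤ k := by exact_mod_cast hk
  have hk0 : (0 : ℝ) < k := by linarith
  have key : ∀ z : ℝ, 0 ≤ z → 0 ≤ z / k ∧ z / k ≤ z := fun z hz =>
    ⟨by positivity, div_le_self hz hk1⟩
  rcases le_total x t with hx | hx <;> rcases le_total y t with hy | hy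
  · rw [min_eq_left hx, min_eq_left hy,
      max_eq_right (div_nonpos_of_nonpos_of_nonneg (by linarith) hk0.le),
      max_eq_right (div_nonpos_of_nonpos_of_nonneg (by linarith) hk0.le)]
    have := key (y - x) (by linarith)
    constructor <;> linarith
  · rw [min_eq_left hx, min_eq_right hy,
      max_eq_left (div_nonneg (by linarith) hk0.le),
      max_eq_right (div_nonpos_of_nonpos_of_nonneg (by linarith) hk0.le)]
    have h1 := key (y - t) (by linarith)
    have h2 := key (t - x) (by linarith)
    have h3 : (y - x) / k = (y - t) / k + (t - x) / k := by ring
    constructor <;> linarith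
  · have : x = y := by linarith
    subst this
    simp
  · rw [min_eq_right hx, min_eq_right hy,
      max_eq_left (div_nonneg (by linarith) hk0.le),
      max_eq_left (div_nonneg (by linarith) hk0.le)]
    have h1 := key (y - x) (by linarith)
    have h3 : (y - x) / k = (y - t) / k - (x - t) / k := by ring
    constructor <;> linarith

theorem resource_mono (hk : 1 ≤ k) {x y : ℝ} (hxy : x ≤ y) :
    resource k h m x ≤ resource k h m y := by
  have h1 := (resource_sub_mem_Icc (h := h) (m := m) hk hxy).1
  have h2 : 0 ≤ (y - x) / k := div_nonneg (by linarith) (by positivity)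
  linarith

theorem resource_le_self (hk : 1 ≤ k) {x : ℝ} (hx : 0 ≤ x) : resource k h m x ≤ x := by
  have h1 := (resource_sub_mem_Icc (h := h) (m := m) hk hx).2
  rw [resource_zero] at h1
  linarith

/-- The resource function saves a whole unit only one unit beyond its kink, and never if `k = 1`. -/
theorem le_of_resource_add_one_le (hk : 1 ≤ k) {x : ℝ} (hx : resource k h m x + 1 ≤ x) :
    2 ≤ k ∧ (2 * k * m / h + 1 : ℝ) ≤ x := by
  simp only [resource] at hx
  generalize (2 * k * m / h : ℝ) = t at *
  rcases le_total x t with hxt | hxt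
  · rw [min_eq_left hxt] at hx
    have := le_max_right ((x - t) / k) 0
    linarith
  · rw [min_eq_right hxt] at hx
    have h1 := le_max_left ((x - t) / k) 0
    have h0 : 0 ≤ (x - t) / k := div_nonneg (by linarith) (by positivity)
    refine ⟨?_, by linarith⟩
    by_contra hk2
    obtain rfl : k = 1 := by omega
    simp only [Nat.cast_one, div_one] at h1 hx
    linarith

end Resource

/-! ### The hard system of an arbitrary group -/

section GroupSystem

variable {N : Type*} [DecidableEq N] {k h m : ℕ}

/-- The system `M(k,h,m)` on an arbitrary ground set, with an arbitrary set `H` in the role of the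
first group. The parameters `k`, `h`, `m` enter only through the resource function and the rank
bound. -/
def groupSystem (k h m : ℕ) (H : Finset N) : Set (Finset N) :=
  {S | resource k h m ((S ∩ H).card : ℝ) + ((S \ H).card : ℝ) ≤ (m : ℝ)}

theorem mem_groupSystem {H S : Finset N} : S ∈ groupSystem k h m H ↔
    resource k h m ((S ∩ H).card : ℝ) + ((S \ H).card : ℝ) ≤ (m : ℝ) := Iff.rfl

theorem groupSystem_of_card_le (hk : 1 ≤ k) {H S : Finset N} {A : Finset N}
    (hA : A ∈ groupSystem k h m H) (h1 : (S ∩ H).card ≤ (A ∩ H).card)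
    (h2 : (S \ H).card ≤ (A \ H).card) : S ∈ groupSystem k h m H := by
  rw [mem_groupSystem] at *
  have h3 : resource k h m ((S ∩ H).card : ℝ) ≤ resource k h m ((A ∩ H).card : ℝ) :=
    resource_mono hk (by exact_mod_cast h1)
  have h4 : ((S \ H).card : ℝ) ≤ ((A \ H).card : ℝ) := by exact_mod_cast h2
  linarith

theorem groupSystem_mono (hk : 1 ≤ k) {H S A : Finset N} (hSA : S ⊆ A)
    (hA : A ∈ groupSystem k h m H) : S ∈ groupSystem k h m H :=
  groupSystem_of_card_le hk hA (card_le_card (inter_subset_inter_right hSA))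
    (card_le_card (sdiff_subset_sdiff hSA subset_rfl))

theorem mem_groupSystem_of_card_le (hk : 1 ≤ k) {H S : Finset N} (hS : S.card ≤ m) :
    S ∈ groupSystem k h m H := by
  have h1 : resource k h m ((S ∩ H).card : ℝ) ≤ (S ∩ H).card :=
    resource_le_self hk (by positivity)
  have h2 : ((S ∩ H).card : ℝ) + (S \ H).card = S.card := by
    exact_mod_cast card_inter_add_card_sdiff S H
  have h3 : (S.card : ℝ) ≤ m := by exact_mod_cast hS
  rw [mem_groupSystem]
  linarith

/-- If more than `k` elements may be removed, an element of `B \ A` outside `H` pays for any new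
element; failing that, a single element of `H` pays for a new element of `H`, and `k` elements of
`H` pay for a new element outside `H`. -/
theorem isKExtendible_groupSystem (hk : 1 ≤ k) (H : Finset N) :
    IsKExtendible k (groupSystem k h m H) := by
  refine ⟨⟨⟨∅, mem_groupSystem_of_card_le hk (by simp)⟩,
    fun A B hAB hB => groupSystem_mono hk hAB hB⟩, ?_⟩
  intro A B x hAB _ hB hxB hxA
  by_cases hsmall : (B \ A).card ≤ k
  · refine ⟨B \ A, subset_rfl, hsmall, ?_⟩
    rwa [Finset.sdiff_sdiff_eq_self hAB]
  push Not at hsmall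
  by_cases hout : ∃ y ∈ B \ A, y ∉ H
  · obtain ⟨y, hy, hyH⟩ := hout
    have hyB : y ∈ B := (mem_sdiff.1 hy).1
    refine ⟨{y}, by simpa using hy, by simpa using hk, ?_⟩
    have hyBH : y ∈ B \ H := mem_sdiff.2 ⟨hyB, hyH⟩
    have hpos : 1 ≤ (B \ H).card := card_pos.2 ⟨y, hyBH⟩
    have e1 : (B \ {y}) ∩ H ⊆ B ∩ H := inter_subset_inter_right sdiff_subset
    have e2 : ((B \ {y}) \ H).card = (B \ H).card - 1 := by
      rw [sdiff_right_comm, sdiff_singleton_eq_erase, card_erase_of_mem hyBH]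
    by_cases hxH : x ∈ H
    · rw [mem_groupSystem] at hB ⊢
      have h1 : ((insert x (B \ {y}) ∩ H).card : ℝ) ≤ (B ∩ H).card + 1 := by
        rw [insert_inter_of_mem hxH]
        exact_mod_cast (card_insert_le _ _).trans (Nat.add_le_add_right (card_le_card e1) 1)
      have h2 : ((insert x (B \ {y}) \ H).card : ℝ) = (B \ H).card - 1 := by
        rw [insert_sdiff_of_mem _ hxH, e2]
        push_cast [hpos]
        ring
      have h3 := resource_mono (h := h) (m := m) hk h1
      have h4 := (resource_sub_mem_Icc (h := h) (m := m) hk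
        (x := ((B ∩ H).card : ℝ)) (y := (B ∩ H).card + 1) (by linarith)).2
      linarith
    · apply groupSystem_of_card_le hk hB
      · rw [insert_inter_of_notMem hxH]
        exact card_le_card e1
      · rw [insert_sdiff_of_notMem _ hxH]
        exact (card_insert_le _ _).trans (by omega)
  · push Not at hout
    have hBAH : B \ A ⊆ B ∩ H := fun y hy => mem_inter.2 ⟨(mem_sdiff.1 hy).1, hout y hy⟩
    by_cases hxH : x ∈ H
    · obtain ⟨y, hy⟩ : (B \ A).Nonempty := card_pos.1 (by omega)
      have hyBH := hBAH hy
      have hpos : 1 ≤ (B ∩ H).card := card_pos.2 ⟨y, hyBH⟩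
      refine ⟨{y}, by simpa using hy, by simpa using hk, ?_⟩
      apply groupSystem_of_card_le hk hB
      · rw [insert_inter_of_mem hxH]
        have : (B \ {y}) ∩ H = (B ∩ H).erase y := by
          rw [sdiff_singleton_eq_erase, erase_inter]
        rw [this]
        have := card_insert_le x ((B ∩ H).erase y)
        rw [card_erase_of_mem hyBH] at this
        omega
      · rw [insert_sdiff_of_mem _ hxH]
        exact card_le_card (sdiff_subset_sdiff sdiff_subset subset_rfl)
    · obtain ⟨Y, hY, hYk⟩ := exists_subset_card_eq hsmall.le
      refine ⟨Y, hY, hYk.le, ?_⟩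
      rw [mem_groupSystem] at hB ⊢
      have hYBH : Y ⊆ B ∩ H := hY.trans hBAH
      have h1 : ((insert x (B \ Y) ∩ H).card : ℝ) + k = (B ∩ H).card := by
        have : insert x (B \ Y) ∩ H = (B ∩ H) \ Y := by
          rw [insert_inter_of_notMem hxH]
          ext z
          simp only [mem_inter, mem_sdiff]
          tauto
        rw [this, ← hYk]
        exact_mod_cast card_sdiff_add_card_eq_card hYBH
      have h2 : ((insert x (B \ Y) \ H).card : ℝ) ≤ (B \ H).card + 1 := by
        rw [insert_sdiff_of_notMem _ hxH]
        exact_mod_cast (card_insert_le _ _).trans (Nat.add_le_add_right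
          (card_le_card (sdiff_subset_sdiff sdiff_subset subset_rfl)) 1)
      have h3 := (resource_sub_mem_Icc (h := h) (m := m) hk
        (x := ((insert x (B \ Y) ∩ H).card : ℝ)) (y := (B ∩ H).card) (by
          have : (0 : ℝ) ≤ k := by positivity
          linarith)).1
      have h4 : (((B ∩ H).card : ℝ) - (insert x (B \ Y) ∩ H).card) / k = 1 := by
        rw [← h1, add_sub_cancel_left]
        exact div_self (by positivity)
      linarith

theorem isKExtendible_uniformSystem (hk : 1 ≤ k) (m : ℕ) :
    IsKExtendible k (uniformSystem N m) := by
  refine ⟨⟨⟨∅, by simp [uniformSystem]⟩, fun A B hAB hB => (card_le_card hAB).trans hB⟩, ?_⟩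
  intro A B x hAB _ hB hxB hxA
  rcases (B \ A).eq_empty_or_nonempty with he | ⟨y, hy⟩
  · refine ⟨∅, by simp, by simp, ?_⟩
    have : B ⊆ A := sdiff_eq_empty_iff_subset.1 he
    rwa [sdiff_empty, Subset.antisymm this hAB]
  · refine ⟨{y}, by simpa using hy, by simpa using hk, ?_⟩
    have hyB : y ∈ B := (mem_sdiff.1 hy).1
    have h1 : 1 ≤ B.card := card_pos.2 ⟨y, hyB⟩
    have h2 := card_insert_le x (B.erase y)
    rw [card_erase_of_mem hyB] at h2
    have h3 : B.card ≤ m := hB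
    rw [sdiff_singleton_eq_erase]
    change _ ≤ m
    omega

theorem permuted_groupSystem (σ : Equiv.Perm N) (H : Finset N) :
    permuted σ (groupSystem k h m H) = groupSystem k h m (H.map σ.toEmbedding) := by
  have key : ∀ S : Finset N, S.map σ.toEmbedding ∈ groupSystem k h m (H.map σ.toEmbedding) ↔
      S ∈ groupSystem k h m H := fun S => by
    rw [mem_groupSystem, mem_groupSystem, ← map_inter, ← Finset.map_sdiff, card_map, card_map]
  ext S
  constructor
  · rintro ⟨S', hS', rfl⟩
    exact (key S').2 hS'
  · intro hS
    refine ⟨S.map σ.symm.toEmbedding, ?_, ?_⟩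
    · rw [← key, map_map]
      simpa using hS
    · simp [map_map]

/-- A group of at least `km` elements contains a large independent set. -/
theorem exists_subset_mem_groupSystem (hk : 1 ≤ k) (hh : 1 ≤ h) (hkh : 2 * k ∣ h)
    {H : Finset N} (hH : k * m ≤ H.card) :
    ∃ S ∈ groupSystem k h m H, S ⊆ H ∧
      S.card = ⌊(k : ℝ) * (m - 2 * k * m / h) + 2 * k * m / h⌋₊ ∧
      (h ≤ 2 * k * m → (m : ℝ) * k * (1 - 2 * k / h) ≤ (S.card : ℝ)) := by
  have hk1 : (1 : ℝ) ≤ k := by exact_mod_cast hk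
  have hh0 : (0 : ℝ) < h := by exact_mod_cast hh
  have hkh' : (2 * k : ℝ) ≤ h := by exact_mod_cast Nat.le_of_dvd hh hkh
  have ht0 : (0 : ℝ) ≤ 2 * k * m / h := by positivity
  have htm : (2 * k * m / h : ℝ) ≤ m := by
    rw [div_le_iff₀ hh0]
    nlinarith [(Nat.cast_nonneg m : (0 : ℝ) ≤ m)]
  have hexp : (m : ℝ) * k * (1 - 2 * k / h) = k * (m - 2 * k * m / h) := by ring
  have hone : h ≤ 2 * k * m → (1 : ℝ) ≤ 2 * k * m / h := fun hle => by
    rw [le_div_iff₀ hh0, one_mul]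
    exact_mod_cast hle
  have hres : ∀ x : ℝ, resource k h m x =
      min x (2 * k * m / h) + max ((x - 2 * k * m / h) / k) 0 := fun _ => rfl
  rw [hexp]
  generalize (2 * k * m / h : ℝ) = t at *
  set a : ℝ := (k : ℝ) * (m - t) + t with ha
  have ha0 : 0 ≤ a := by
    have : 0 ≤ (k : ℝ) * (m - t) := mul_nonneg (by linarith) (by linarith)
    linarith
  have hfl : (⌊a⌋₊ : ℝ) ≤ a := Nat.floor_le ha0
  have hcard : ⌊a⌋₊ ≤ H.card := by
    refine le_trans ?_ hH
    have : (⌊a⌋₊ : ℝ) ≤ k * m := by nlinarith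
    exact_mod_cast this
  obtain ⟨S, hSH, hS⟩ := exists_subset_card_eq hcard
  refine ⟨S, ?_, hSH, hS, fun hle => ?_⟩
  · rw [mem_groupSystem, inter_eq_left.2 hSH, sdiff_eq_empty_iff_subset.2 hSH, hS, hres]
    simp only [card_empty, Nat.cast_zero, add_zero]
    rcases le_total (⌊a⌋₊ : ℝ) t with hc | hc
    · rw [min_eq_left hc, max_eq_right (div_nonpos_of_nonpos_of_nonneg (by linarith) (by linarith))]
      linarith
    · rw [min_eq_right hc, max_eq_left (div_nonneg (by linarith) (by linarith))]
      have : (⌊a⌋₊ - t) / k ≤ m - t := by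
        rw [div_le_iff₀ (by linarith)]
        linarith
      linarith
  · rw [hS]
    have := Nat.lt_floor_add_one a
    linarith [hone hle]

end GroupSystem

/-! ### Random images of a set -/

section RandomImage

variable {N : Type*} [Fintype N] [DecidableEq N]

/-- Adding a point to `T` divides the number of permutations `σ` with `T ⊆ σ(H)` by at least
`|N| / |H|`: by symmetry all points outside `T` are equally likely to be covered too, and the
points of `T` are covered anyway. -/
theorem card_mul_card_perm_insert_le (H T : Finset N) {x : N} (hx : x ∉ T) :
    Fintype.card N *
        (univ.filter fun σ : Equiv.Perm N => insert x T ⊆ H.map σ.toEmbedding).card ≤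
      H.card * (univ.filter fun σ : Equiv.Perm N => T ⊆ H.map σ.toEmbedding).card := by
  have hle : ∀ y : N,
      (univ.filter fun σ : Equiv.Perm N => insert x T ⊆ H.map σ.toEmbedding).card ≤
      (univ.filter fun σ : Equiv.Perm N => insert y T ⊆ H.map σ.toEmbedding).card := by
    intro y
    by_cases hy : y ∈ T
    · refine card_le_card (monotone_filter_right _ fun σ _ hσ => ?_)
      rw [insert_eq_of_mem hy]
      exact (subset_insert x T).trans hσ
    · refine card_le_card_of_injOn (fun σ => Equiv.swap x y * σ) ?_
        (fun σ _ τ _ hστ => mul_left_cancel hστ)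
      intro σ hσ
      simp only [coe_filter, mem_univ, true_and, Set.mem_ofPred_eq, subset_iff, mem_map_equiv,
        forall_mem_insert] at hσ ⊢
      have hinv : ∀ z, (Equiv.swap x y * σ).symm z = σ.symm (Equiv.swap x y z) := fun z => by
        rw [Equiv.symm_apply_eq]
        simp
      refine ⟨by simpa [hinv] using hσ.1, fun z hz => ?_⟩
      rw [hinv, Equiv.swap_apply_of_ne_of_ne (ne_of_mem_of_not_mem hz hx)
        (ne_of_mem_of_not_mem hz hy)]
      exact hσ.2 z hz
  calc _ = ∑ _y : N,
        (univ.filter fun σ : Equiv.Perm N => insert x T ⊆ H.map σ.toEmbedding).card := by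
          rw [sum_const, card_univ, smul_eq_mul]
    _ ≤ ∑ y : N,
        (univ.filter fun σ : Equiv.Perm N => insert y T ⊆ H.map σ.toEmbedding).card :=
          sum_le_sum fun y _ => hle y
    _ = ∑ y : N, ∑ σ ∈ univ.filter fun σ : Equiv.Perm N => T ⊆ H.map σ.toEmbedding,
          if y ∈ H.map σ.toEmbedding then 1 else 0 := by
          refine sum_congr rfl fun y _ => ?_
          rw [← card_filter, filter_filter]
          congr 1
          ext σ
          simp only [mem_filter, insert_subset_iff]
          tauto
    _ = ∑ σ ∈ univ.filter fun σ : Equiv.Perm N => T ⊆ H.map σ.toEmbedding, H.card := by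
          rw [sum_comm]
          refine sum_congr rfl fun σ _ => ?_
          rw [← card_filter, filter_mem_eq_inter, univ_inter, card_map]
    _ = _ := by rw [sum_const, smul_eq_mul, mul_comm]

theorem pow_mul_card_perm_subset_le {h : ℕ} {H : Finset N} (hH : 0 < H.card)
    (hN : Fintype.card N = h * H.card) (T : Finset N) :
    h ^ T.card * (univ.filter fun σ : Equiv.Perm N => T ⊆ H.map σ.toEmbedding).card ≤
      Fintype.card (Equiv.Perm N) := by
  induction T using Finset.induction_on with
  | empty => simp
  | insert x T hx ih =>
    have h1 := card_mul_card_perm_insert_le H T hx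
    rw [hN, mul_comm h, mul_assoc] at h1
    have h2 := Nat.le_of_mul_le_mul_left h1 hH
    rw [card_insert_of_notMem hx, pow_succ, mul_assoc]
    exact (Nat.mul_le_mul_left _ h2).trans ih

/-- The exponential moment of `|S ∩ σ(H)|` at base `2`: `2 ^ |S ∩ σ(H)|` counts the sets `T ⊆ S`
that are covered by `σ(H)`. -/
theorem sum_two_pow_card_inter_le {h : ℕ} (hh : 1 ≤ h) {H : Finset N} (hH : 0 < H.card)
    (hN : Fintype.card N = h * H.card) (S : Finset N) :
    ∑ σ : Equiv.Perm N, (2 : ℝ) ^ (S ∩ H.map σ.toEmbedding).card ≤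
      Fintype.card (Equiv.Perm N) * (1 + 1 / (h : ℝ)) ^ S.card := by
  have hh0 : (0 : ℝ) < h := by exact_mod_cast hh
  calc ∑ σ : Equiv.Perm N, (2 : ℝ) ^ (S ∩ H.map σ.toEmbedding).card
      = ∑ σ : Equiv.Perm N, ∑ T ∈ S.powerset,
          if T ⊆ H.map σ.toEmbedding then (1 : ℝ) else 0 := by
        refine sum_congr rfl fun σ _ => ?_
        have : (S.powerset.filter fun T => T ⊆ H.map σ.toEmbedding) =
            (S ∩ H.map σ.toEmbedding).powerset := by
          ext T
          simp only [mem_filter, mem_powerset, subset_inter_iff]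
        rw [← sum_filter, this, sum_const, card_powerset]
        simp
    _ = ∑ T ∈ S.powerset,
          ((univ.filter fun σ : Equiv.Perm N => T ⊆ H.map σ.toEmbedding).card : ℝ) := by
        rw [sum_comm]
        exact sum_congr rfl fun T _ => by simp
    _ ≤ ∑ T ∈ S.powerset, Fintype.card (Equiv.Perm N) *
          ((1 / (h : ℝ)) ^ T.card * 1 ^ (S.card - T.card)) := by
        refine sum_le_sum fun T _ => ?_
        rw [one_pow, mul_one, one_div, inv_pow, ← div_eq_mul_inv, le_div_iff₀ (by positivity),
          mul_comm]
        exact_mod_cast pow_mul_card_perm_subset_le hH hN T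
    _ = _ := by
        rw [← mul_sum, sum_pow_mul_eq_add_pow, add_comm]

theorem permProb_eq (E : Equiv.Perm N → Prop) [DecidablePred E] :
    permProb E = ((univ.filter E).card : ℝ) / Fintype.card (Equiv.Perm N) := by
  rw [permProb, Nat.card_eq_fintype_card, Nat.card_eq_fintype_card, Fintype.card_subtype]

theorem permProb_mono {E F : Equiv.Perm N → Prop} (hEF : ∀ σ, E σ → F σ) :
    permProb E ≤ permProb F := by
  classical
  rw [permProb_eq, permProb_eq]
  gcongr with σ
  exact hEF σ

theorem permProb_or_le (E F : Equiv.Perm N → Prop) :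
    permProb (fun σ => E σ ∨ F σ) ≤ permProb E + permProb F := by
  classical
  rw [permProb_eq, permProb_eq, permProb_eq, ← add_div, filter_or]
  gcongr
  exact_mod_cast card_union_le _ _

theorem permProb_eq_zero {E : Equiv.Perm N → Prop} (hE : ∀ σ, ¬ E σ) : permProb E = 0 := by
  classical
  rw [permProb_eq, filter_false_of_mem fun σ _ => hE σ]
  simp

/-- Chernoff's bound for `|S ∩ σ(H)|`, by Markov's inequality for `2 ^ |S ∩ σ(H)|`. -/
theorem permProb_le_card_inter_le {h : ℕ} (hh : 1 ≤ h) {H : Finset N} (hH : 0 < H.card)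
    (hN : Fintype.card N = h * H.card) (S : Finset N) (a : ℝ) :
    permProb (fun σ : Equiv.Perm N => a ≤ ((S ∩ H.map σ.toEmbedding).card : ℝ)) ≤
      Real.exp (S.card / h - a * Real.log 2) := by
  classical
  rw [permProb_eq, div_le_iff₀ (by exact_mod_cast Fintype.card_pos), Real.exp_sub,
    div_mul_eq_mul_div, le_div_iff₀ (Real.exp_pos _)]
  calc _ = ∑ σ ∈ univ.filter fun σ : Equiv.Perm N => a ≤ ((S ∩ H.map σ.toEmbedding).card : ℝ),
        Real.exp (a * Real.log 2) := by rw [sum_const, nsmul_eq_mul]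
    _ ≤ ∑ σ ∈ univ.filter fun σ : Equiv.Perm N => a ≤ ((S ∩ H.map σ.toEmbedding).card : ℝ),
        (2 : ℝ) ^ (S ∩ H.map σ.toEmbedding).card := by
        refine sum_le_sum fun σ hσ => ?_
        rw [← Real.exp_log (show (0 : ℝ) < 2 ^ (S ∩ H.map σ.toEmbedding).card by positivity),
          Real.log_pow]
        exact Real.exp_le_exp.2
          (mul_le_mul_of_nonneg_right (mem_filter.1 hσ).2 (Real.log_nonneg one_le_two))
    _ ≤ ∑ σ : Equiv.Perm N, (2 : ℝ) ^ (S ∩ H.map σ.toEmbedding).card :=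
        sum_le_sum_of_subset_of_nonneg (filter_subset _ _) fun _ _ _ => by positivity
    _ ≤ Fintype.card (Equiv.Perm N) * (1 + 1 / (h : ℝ)) ^ S.card :=
        sum_two_pow_card_inter_le hh hH hN S
    _ ≤ Real.exp (S.card / h) * Fintype.card (Equiv.Perm N) := by
        rw [mul_comm]
        gcongr
        rw [div_eq_mul_one_div (S.card : ℝ), Real.exp_nat_mul]
        gcongr
        rw [add_comm]
        exact Real.add_one_le_exp _

end RandomImage

/-! ### Indistinguishability of the hard and the uniform system -/

section Indistinguishable

variable {N : Type*} [Fintype N] [DecidableEq N] {k h m : ℕ}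

/-- A fixed independence query rarely tells the system of `σ(H)` from the uniform matroid. Only
queries with more than `m` elements can do so; such a query may be cut down to `m + 1` elements,
and then at least `2km/h + 1` of these lie in `σ(H)`, while the expected number is `(m + 1)/h`. -/
theorem permProb_query_differs_le (hk : 1 ≤ k) (hh : 1 ≤ h) (hkh : 2 * k ∣ h)
    {H : Finset N} (hH : 0 < H.card) (hN : Fintype.card N = h * H.card) (S : Finset N) :
    permProb (fun σ : Equiv.Perm N =>
        ¬ (S ∈ groupSystem k h m (H.map σ.toEmbedding) ↔ S ∈ uniformSystem N m)) ≤
      Real.exp (-(2 * k * m / (h : ℝ) ^ 2)) := by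
  have hnonneg := (Real.exp_pos (-(2 * k * m / (h : ℝ) ^ 2))).le
  by_cases hS : S.card ≤ m
  · rw [permProb_eq_zero]
    · exact hnonneg
    · exact fun σ => not_not.2 (iff_of_true (mem_groupSystem_of_card_le hk hS) hS)
  obtain ⟨S', hS'S, hS'⟩ := exists_subset_card_eq (show m + 1 ≤ S.card by omega)
  have key : ∀ σ : Equiv.Perm N,
      ¬ (S ∈ groupSystem k h m (H.map σ.toEmbedding) ↔ S ∈ uniformSystem N m) →
      2 ≤ k ∧ (2 * k * m / h + 1 : ℝ) ≤ ((S' ∩ H.map σ.toEmbedding).card : ℝ) := by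
    intro σ hσ
    have hSu : S ∉ uniformSystem N m := hS
    simp only [hSu, iff_false, not_not] at hσ
    have h1 := groupSystem_mono hk hS'S hσ
    rw [mem_groupSystem] at h1
    have h2 : ((S' ∩ H.map σ.toEmbedding).card : ℝ) + (S' \ H.map σ.toEmbedding).card = m + 1 := by
      exact_mod_cast (card_inter_add_card_sdiff S' _).trans hS'
    exact le_of_resource_add_one_le hk (by linarith)
  by_cases hk2 : 2 ≤ k
  · refine (permProb_mono fun σ hσ => (key σ hσ).2).trans
      ((permProb_le_card_inter_le hh hH hN S' _).trans (Real.exp_le_exp.2 ?_))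
    have hkh' : (2 * k : ℝ) ≤ h := by exact_mod_cast Nat.le_of_dvd hh hkh
    have hk2' : (2 : ℝ) ≤ k := by exact_mod_cast hk2
    have hh0 : (0 : ℝ) < h := by linarith
    rw [hS']
    push_cast
    have hlog := Real.log_two_gt_d9
    set u : ℝ := m / h with hu
    have hu0 : 0 ≤ u := by positivity
    have e1 : ((m : ℝ) + 1) / h = u + 1 / h := add_div _ _ _
    have e2 : (2 * k * m / h : ℝ) = 2 * k * u := by rw [hu]; ring
    have e3 : (2 * k * m / (h : ℝ) ^ 2) = 2 * k / h * u := by rw [hu]; field_simp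
    have e4 : (2 * k / h : ℝ) ≤ 1 := (div_le_one hh0).2 hkh'
    have e5 : (1 / h : ℝ) ≤ 1 / 4 := one_div_le_one_div_of_le (by norm_num) (by linarith)
    have e6 : (2 * k / h : ℝ) * u ≤ u := mul_le_of_le_one_left hu0 e4
    have e7 : 4 * u + 1 ≤ 2 * k * u + 1 := by nlinarith
    have e8 : (4 * u + 1) * (69 / 100) ≤ (2 * k * u + 1) * Real.log 2 :=
      mul_le_mul e7 (by linarith) (by norm_num) (by linarith)
    rw [e1, e2, e3]
    linarith
  · rw [permProb_eq_zero fun σ hσ => hk2 (key σ hσ).1]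
    exact hnonneg

/-- A decision tree is misled only if one of the queries on its path for the uniform matroid is
answered differently. -/
theorem permProb_run_ne_le {β : Type*} (hk : 1 ≤ k) (hh : 1 ≤ h) (hkh : 2 * k ∣ h)
    {H : Finset N} (hH : 0 < H.card) (hN : Fintype.card N = h * H.card)
    (A : OracleAlgorithm N β) :
    permProb (fun σ : Equiv.Perm N =>
        A.run (cardProblem (groupSystem k h m (H.map σ.toEmbedding))) ≠
          A.run (cardProblem (uniformSystem N m))) ≤
      (A.numQueries (cardProblem (uniformSystem N m)) : ℝ) *
        Real.exp (-(2 * k * m / (h : ℝ) ^ 2)) := by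
  classical
  induction A with
  | output b =>
    rw [permProb_eq_zero fun σ hσ => hσ rfl]
    simp [OracleAlgorithm.numQueries]
  | valueQuery S next ih =>
    simp only [OracleAlgorithm.run, OracleAlgorithm.numQueries]
    refine (ih (S.card : ℝ)).trans ?_
    gcongr
    exact Nat.le_succ _
  | indepQuery S next ih =>
    simp only [OracleAlgorithm.run, OracleAlgorithm.numQueries]
    refine (permProb_mono ?_).trans ((permProb_or_le _ _).trans
      (add_le_add (permProb_query_differs_le (m := m) hk hh hkh hH hN S)
        (ih (decide (S ∈ uniformSystem N m))))) |>.trans_eq ?_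
    · intro σ hσ
      by_contra hcon
      rw [not_or, not_not, not_not] at hcon
      refine hσ ?_
      have : decide (S ∈ (cardProblem (groupSystem k h m (H.map σ.toEmbedding))).indep) =
          decide (S ∈ uniformSystem N m) := decide_eq_decide.2 hcon.1
      simp only [this]
      exact hcon.2
    · rw [Nat.cast_add, Nat.cast_one, add_mul, one_mul, add_comm]
      rfl

end Indistinguishable

/-! ### Averaging over permutations and seeds -/

section Averaging

variable {N : Type*} [DecidableEq N] {k h m : ℕ}

theorem groupSystem_mem_cardProblems (hk : 1 ≤ k) (hm : 1 ≤ m) (H : Finset N) :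
    cardProblem (groupSystem k h m H) ∈ cardProblems k N :=
  ⟨_, isKExtendible_groupSystem hk H, fun x => mem_groupSystem_of_card_le hk (by simpa using hm),
    rfl⟩

theorem uniformSystem_mem_cardProblems (hk : 1 ≤ k) (hm : 1 ≤ m) :
    cardProblem (uniformSystem N m) ∈ cardProblems k N :=
  ⟨_, isKExtendible_uniformSystem hk m, fun x => by simpa [uniformSystem] using hm, rfl⟩

theorem cardProblems_subset_linearProblems : cardProblems k N ⊆ linearProblems k N := by
  rintro _ ⟨I, hI, hs, rfl⟩
  refine ⟨hI, hs, fun A B x hAB hxB => ?_, fun S => by simp [cardProblem]⟩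
  have hxA : x ∉ A := fun hx => hxB (hAB hx)
  simp [cardProblem, card_insert_of_notMem hxA, card_insert_of_notMem hxB]

theorem integrable_value_run [Fintype N] (A : RandomizedAlgorithm.{u} N) (P : Problem N)
    (hmeas : ∀ T : Finset N, MeasurableSet {ω | (A.alg ω).run P = T}) :
    MeasureTheory.Integrable (fun ω => P.value ((A.alg ω).run P)) A.law := by
  have : (fun ω => P.value ((A.alg ω).run P)) = fun ω => ∑ T : Finset N,
      Set.indicator {ω | (A.alg ω).run P = T} (fun _ => P.value T) ω := by
    funext ω
    simp [Set.indicator_apply]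
  rw [this]
  exact MeasureTheory.integrable_finsetSum _ fun T _ =>
    (MeasureTheory.integrable_const _).indicator (hmeas T)

/-- A randomized algorithm with few queries finds only little more than `m` elements in a random
copy of the hard system, although there is an independent set of `km(1 - 2k/h)` elements. -/
theorem ratio_bound_of_approximates [Fintype N] (hk : 1 ≤ k) (hh : 1 ≤ h) (hm : 1 ≤ m)
    (hkh : 2 * k ∣ h) (hhm : h ≤ 2 * k * m) (hN : Fintype.card N = h * (k * m))
    {q : ℕ} {α : ℝ} (hα : 0 ≤ α)
    (A : RandomizedAlgorithm.{u} N) (hA : A.Approximates (cardProblems k N) q α) :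
    (m : ℝ) * k * (1 - 2 * k / h) ≤
      α * (m + Fintype.card N * (q * Real.exp (-(2 * k * m / (h : ℝ) ^ 2)))) := by
  classical
  obtain ⟨H, -, hH⟩ := exists_subset_card_eq
    (show k * m ≤ (univ : Finset N).card by rw [card_univ, hN]; exact Nat.le_mul_of_pos_left _ hh)
  have hH0 : 0 < H.card := by rw [hH]; positivity
  set P : Equiv.Perm N → Problem N := fun σ =>
    cardProblem (groupSystem k h m (H.map σ.toEmbedding)) with hP
  set U : Problem N := cardProblem (uniformSystem N m) with hU
  set δ : ℝ := q * Real.exp (-(2 * k * m / (h : ℝ) ^ 2)) with hδ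
  set F : ℝ := (Fintype.card (Equiv.Perm N) : ℝ) with hF
  have hF0 : 0 < F := by rw [hF]; exact_mod_cast Fintype.card_pos
  have hPA := fun σ => hA (P σ) (groupSystem_mem_cardProblems hk hm _)
  have hUA := hA U (uniformSystem_mem_cardProblems hk hm)
  have hint := fun σ => integrable_value_run A (P σ) (hPA σ).1
  have hlower : ∀ σ, (m : ℝ) * k * (1 - 2 * k / h) ≤
      α * ∫ ω, (P σ).value ((A.alg ω).run (P σ)) ∂A.law := by
    intro σ
    obtain ⟨S, hS, -, -, hcard⟩ := exists_subset_mem_groupSystem hk hh hkh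
      (H := H.map σ.toEmbedding) (m := m) (by rw [card_map, hH])
    exact (hcard hhm).trans ((hPA σ).2.2.2 S hS)
  have hupper : ∀ᵐ ω ∂A.law,
      ∑ σ, (P σ).value ((A.alg ω).run (P σ)) ≤ F * (m + Fintype.card N * δ) := by
    filter_upwards [hUA.2.1, hUA.2.2.1] with ω hq hind
    have hprob := (permProb_run_ne_le (m := m) hk hh hkh hH0 (by rw [hN, hH]) (A.alg ω)).trans
      (mul_le_mul_of_nonneg_right (show _ ≤ (q : ℝ) by exact_mod_cast hq) (Real.exp_pos _).le)
    rw [permProb_eq, div_le_iff₀ hF0] at hprob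
    have hpt : ∀ σ, (P σ).value ((A.alg ω).run (P σ)) ≤
        m + Fintype.card N * (if (A.alg ω).run (P σ) ≠ (A.alg ω).run U then (1 : ℝ) else 0) := by
      intro σ
      change (((A.alg ω).run (P σ)).card : ℝ) ≤ _
      split_ifs with hne
      · have : (((A.alg ω).run (P σ)).card : ℝ) ≤ Fintype.card N := by
          exact_mod_cast card_le_univ _
        have : (0 : ℝ) ≤ m := by positivity
        linarith
      · rw [not_ne_iff.1 hne, mul_zero, add_zero]
        exact_mod_cast (show ((A.alg ω).run U).card ≤ m from hind)
    refine (sum_le_sum fun σ _ => hpt σ).trans ?_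
    rw [sum_add_distrib, ← mul_sum, sum_boole, sum_const, card_univ, nsmul_eq_mul, mul_add]
    have := mul_le_mul_of_nonneg_left hprob (Nat.cast_nonneg (α := ℝ) (Fintype.card N))
    calc _ ≤ F * m + Fintype.card N * (δ * F) := add_le_add_right this _
      _ = _ := by ring
  have hsum : ∑ σ, ∫ ω, (P σ).value ((A.alg ω).run (P σ)) ∂A.law ≤
      F * (m + Fintype.card N * δ) := by
    rw [← MeasureTheory.integral_finsetSum _ fun σ _ => hint σ]
    refine (MeasureTheory.integral_mono_ae
      (MeasureTheory.integrable_finsetSum _ fun σ _ => hint σ)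
      (MeasureTheory.integrable_const _) hupper).trans_eq ?_
    simp
  have htotal : F * ((m : ℝ) * k * (1 - 2 * k / h)) ≤ F * (α * (m + Fintype.card N * δ)) := by
    calc F * ((m : ℝ) * k * (1 - 2 * k / h))
        = ∑ _σ : Equiv.Perm N, (m : ℝ) * k * (1 - 2 * k / h) := by
          rw [sum_const, card_univ, nsmul_eq_mul]
      _ ≤ ∑ σ, α * ∫ ω, (P σ).value ((A.alg ω).run (P σ)) ∂A.law :=
          sum_le_sum fun σ _ => hlower σ
      _ ≤ α * (F * (m + Fintype.card N * δ)) := by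
          rw [← mul_sum]
          exact mul_le_mul_of_nonneg_left hsum hα
      _ = _ := by ring
  exact le_of_mul_le_mul_left htotal hF0

end Averaging

/-! ### Polynomially many queries -/

open Filter Topology in
theorem tendsto_natPolynomial_mul_exp (p : Polynomial ℕ) (a : ℕ) {c : ℝ} (hc : 0 < c) :
    Tendsto (fun m : ℕ => ((p.eval (a * m) : ℕ) : ℝ) * Real.exp (-(c * m))) atTop (𝓝 0) := by
  -- the substitution `x = c * m` turns `p (a * m)` into a real polynomial in `x`
  let Q : Polynomial ℝ :=
    (p.map (Nat.castRingHom ℝ)).comp (Polynomial.C (a / c : ℝ) * Polynomial.X)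
  have h1 : Tendsto (fun m : ℕ => c * (m : ℝ)) atTop atTop :=
    tendsto_natCast_atTop_atTop.const_mul_atTop hc
  refine ((Polynomial.tendsto_div_exp_atTop Q).comp h1).congr fun m => ?_
  have h2 : (a / c : ℝ) * (c * m) = ((a * m : ℕ) : ℝ) := by
    push_cast
    field_simp
  simp only [Function.comp_apply, Q, Polynomial.eval_comp, Polynomial.eval_mul, Polynomial.eval_C,
    Polynomial.eval_X, h2]
  rw [Polynomial.eval_natCast_map, Real.exp_neg, div_eq_mul_inv]
  simp

open Filter Topology in
/-- With `h = 2kr` for a large constant `r`, the attainable ratio is at least `k(1 - 1/r)` up to an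
error that vanishes as `m → ∞`. -/
theorem not_hasPolyQueryApproximation_cardProblems {k : ℕ} (hk : 1 ≤ k) {ε : ℝ} (hε : 0 < ε) :
    ¬ HasPolyQueryApproximation.{u} (fun n => cardProblems k (Fin n)) ((k : ℝ) - ε) := by
  rintro ⟨p, A, hA⟩
  have hk0 : (0 : ℝ) < k := by exact_mod_cast hk
  -- enlarging a negative ratio to `0` keeps the guarantee, as cardinalities are non-negative
  set α : ℝ := max (k - ε) 0 with hα
  have hα0 : 0 ≤ α := le_max_right _ _
  have hαk : α < k := max_lt (by linarith) hk0
  have hA' : ∀ n, (A n).Approximates (cardProblems k (Fin n)) (p.eval n) α := by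
    rintro n _ ⟨I, hI, hs, rfl⟩
    obtain ⟨h1, h2, h3, h4⟩ := hA n _ ⟨I, hI, hs, rfl⟩
    refine ⟨h1, h2, h3, fun S hS => (h4 S hS).trans ?_⟩
    refine mul_le_mul_of_nonneg_right (le_max_left _ _) ?_
    exact MeasureTheory.integral_nonneg fun ω => by simp [cardProblem]
  obtain ⟨r, hr⟩ := exists_nat_gt (k / (k - α))
  have hr0 : (0 : ℝ) < r := lt_of_le_of_lt (div_nonneg hk0.le (by linarith)) hr
  have hr1 : 1 ≤ r := by exact_mod_cast hr0
  rw [div_lt_iff₀ (by linarith)] at hr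
  set h : ℕ := 2 * k * r with hh
  have hh1 : 1 ≤ h := Nat.mul_pos (by omega) hr1
  have hh0 : (0 : ℝ) < h := by exact_mod_cast hh1
  have hc : (0 : ℝ) < 2 * k / (h : ℝ) ^ 2 := by positivity
  have hlim : Tendsto (fun m : ℕ => α * (1 + (h * k : ℕ) *
      (((p.eval (h * k * m) : ℕ) : ℝ) * Real.exp (-(2 * k / (h : ℝ) ^ 2 * m))))) atTop (𝓝 α) := by
    have := ((tendsto_natPolynomial_mul_exp p (h * k) hc).const_mul ((h * k : ℕ) : ℝ)).const_add 1
      |>.const_mul α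
    simpa using this
  have hbound : ∀ᶠ m : ℕ in atTop, (k : ℝ) * (1 - 2 * k / h) ≤ α * (1 + (h * k : ℕ) *
      (((p.eval (h * k * m) : ℕ) : ℝ) * Real.exp (-(2 * k / (h : ℝ) ^ 2 * m)))) := by
    filter_upwards [eventually_ge_atTop h] with m hm
    have hm1 : 1 ≤ m := hh1.trans hm
    have hm0 : (0 : ℝ) < m := by exact_mod_cast hm1
    have := ratio_bound_of_approximates (m := m) (N := Fin (h * k * m)) hk hh1 hm1
      (Dvd.intro r rfl) (hm.trans (Nat.le_mul_of_pos_left m (by positivity)))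
      (by rw [Fintype.card_fin, mul_assoc]) hα0 (A _) (hA' _)
    rw [Fintype.card_fin] at this
    refine le_of_mul_le_mul_left ?_ hm0
    calc (m : ℝ) * (k * (1 - 2 * k / h)) = m * k * (1 - 2 * k / h) := by ring
      _ ≤ _ := this
      _ = _ := by
        have e : (2 * k * m / (h : ℝ) ^ 2) = 2 * k / (h : ℝ) ^ 2 * m := by ring
        rw [e]
        push_cast
        ring
  have hle : (k : ℝ) * (1 - 2 * k / h) ≤ α := ge_of_tendsto hlim hbound
  have he : (2 * k / h : ℝ) = 1 / r := by
    rw [hh]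
    push_cast
    field_simp
  rw [he] at hle
  have : (k : ℝ) * (1 - 1 / r) * r = k * r - k := by field_simp
  nlinarith [mul_le_mul_of_nonneg_right hle hr0.le]

theorem not_hasPolyQueryApproximation_linearProblems {k : ℕ} (hk : 1 ≤ k) {ε : ℝ} (hε : 0 < ε) :
    ¬ HasPolyQueryApproximation.{u} (fun n => linearProblems k (Fin n)) ((k : ℝ) - ε) :=
  fun ⟨p, A, hA⟩ => not_hasPolyQueryApproximation_cardProblems hk hε
    ⟨p, A, fun n P hP => hA n P (cardProblems_subset_linearProblems hP)⟩

theorem card_firstGroup {k h m : ℕ} (hh : 1 ≤ h) : (firstGroup k h m).card = k * m := by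
  have : firstGroup k h m = ({⟨0, hh⟩} : Finset (Fin h)) ×ˢ univ := by
    ext x
    simp only [firstGroup, mem_filter, mem_univ, true_and, mem_product, mem_singleton, and_true,
      Fin.ext_iff]
  rw [this, card_product]
  simp

end KExtHardness

theorem mainTheorem5 (k : ℕ) (hk : 1 ≤ k) :
    (∀ ε : ℝ, 0 < ε →
      ¬ KExtHardness.HasPolyQueryApproximation.{u}
          (fun n => KExtHardness.linearProblems k (Fin n)) ((k : ℝ) - ε)) ∧
    (∀ ε : ℝ, 0 < ε →
      ¬ KExtHardness.HasPolyQueryApproximation.{u}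
          (fun n => KExtHardness.cardProblems k (Fin n)) ((k : ℝ) - ε)) ∧
    ∀ h m : ℕ, 1 ≤ h → 1 ≤ m → 2 * k ∣ h →
      KExtHardness.IsKExtendible k (KExtHardness.hardSystem k h m) ∧
      KExtHardness.IsKExtendible k
        (KExtHardness.uniformSystem (KExtHardness.Ground k h m) m) ∧
      (∃ S ∈ KExtHardness.hardSystem k h m, S ⊆ KExtHardness.firstGroup k h m ∧
        S.card = ⌊(k : ℝ) * (m - 2 * k * m / h) + 2 * k * m / h⌋₊ ∧
        (h ≤ 2 * k * m → (m : ℝ) * k * (1 - 2 * k / h) ≤ (S.card : ℝ))) ∧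
      ∀ (β : Type u) (A : KExtHardness.OracleAlgorithm (KExtHardness.Ground k h m) β),
        KExtHardness.permProb (fun σ : Equiv.Perm (KExtHardness.Ground k h m) =>
            A.run (KExtHardness.cardProblem
                (KExtHardness.permuted σ (KExtHardness.hardSystem k h m))) ≠
              A.run (KExtHardness.cardProblem
                (KExtHardness.uniformSystem (KExtHardness.Ground k h m) m))) ≤
          (A.numQueries (KExtHardness.cardProblem
              (KExtHardness.uniformSystem (KExtHardness.Ground k h m) m)) : ℝ) *
            Real.exp (-(2 * k * m / (h : ℝ) ^ 2)) := by
  refine ⟨fun ε hε => KExtHardness.not_hasPolyQueryApproximation_linearProblems hk hε,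
    fun ε hε => KExtHardness.not_hasPolyQueryApproximation_cardProblems hk hε,
    fun h m hh hm hkh => ⟨KExtHardness.isKExtendible_groupSystem hk _,
      KExtHardness.isKExtendible_uniformSystem hk m,
      KExtHardness.exists_subset_mem_groupSystem hk hh hkh
        (KExtHardness.card_firstGroup hh).ge, fun β A => ?_⟩⟩
  have hcard := KExtHardness.card_firstGroup (k := k) (m := m) hh
  have key := KExtHardness.permProb_run_ne_le (m := m) hk hh hkh
    (H := KExtHardness.firstGroup k h m) (by rw [hcard]; positivity) (by rw [hcard]; simp) A
  simp only [← KExtHardness.permuted_groupSystem] at key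
  exact key
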